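/- Let $\chi(s)=\dfrac{(2\pi)^s}{2\,\Gamma(s)\cos\frac{\pi s}{2}}$ be the factor in the functional equation $\zeta(s)=\chi(s)\zeta(1-s)$ of the Riemann zeta function. On $\Omega=\mathbf{C}\smallsetminus\bigl((-\infty,0]\cup[1,\infty)\bigr)$ let $\log\chi(s)$ denote the holomorphic branch of the logarithm of $\chi$ with $\log\chi(\tfrac12)=0$, and let \[\vartheta(t)=-\frac{1}{2i}\log\chi(\tfrac12+it)\] be the Riemann–Siegel theta function, which is analytic on $\mathbf{C}$ minus the two cuts $i[\tfrac12,\infty)$ and $-i[\tfrac12,\infty)$. Then for every complex $t$ with $|t|\ge 4$ and $|\Re t|\ge 1$, \[|\vartheta(t)|\le 2|t|\log|t|.\] -/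

import Mathlib

noncomputable section

/-- The factor `χ(s) = (2π)^s / (2 Γ(s) cos(πs/2))` of the functional equation
`ζ(s) = χ(s) ζ(1 - s)`. -/
def zetaChi (s : ℂ) : ℂ :=
  (2 * (Real.pi : ℂ)) ^ s / (2 * Complex.Gamma s * Complex.cos ((Real.pi : ℂ) * s / 2))

/-- The complex plane with the two cuts `(-∞, 0]` and `[1, ∞)` along the real axis. -/
def cutPlane : Set ℂ :=
  {s : ℂ | ¬ (s.im = 0 ∧ (s.re ≤ 0 ∨ 1 ≤ s.re))}

/-- `L` is the holomorphic branch of `log χ` on the cut plane with `log χ(1/2) = 0`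
(its values on the cuts are irrelevant). -/
def IsLogChi (L : ℂ → ℂ) : Prop :=
  DifferentiableOn ℂ L cutPlane ∧ (∀ s ∈ cutPlane, Complex.exp (L s) = zetaChi s) ∧ L (1 / 2) = 0

theorem isOpen_cutPlane : IsOpen cutPlane := by
  have h : IsClosed {s : ℂ | s.im = 0 ∧ (s.re ≤ 0 ∨ 1 ≤ s.re)} :=
    (isClosed_eq Complex.continuous_im continuous_const).inter
      ((isClosed_le Complex.continuous_re continuous_const).union
        (isClosed_le continuous_const Complex.continuous_re))
  exact h.isOpen_compl

theorem half_mem_cutPlane : (1 / 2 : ℂ) ∈ cutPlane := by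
  norm_num [cutPlane]

theorem starConvex_cutPlane : StarConvex ℝ (1 / 2 : ℂ) cutPlane := by
  intro s hs a b ha hb hab h
  apply hs
  obtain ⟨h1, h2⟩ := h
  simp at h1 h2
  rcases h1 with h1 | h1
  · subst h1
    have : a = 1 := by linarith
    subst this
    norm_num at h2
  · refine ⟨h1, ?_⟩
    by_contra! h3
    rcases h2 with h2 | h2
    · have := mul_nonneg hb h3.1.le
      rcases hb.eq_or_lt with rfl | hb
      · have : a = 1 := by linarith
        subst this
        norm_num at h2
      · nlinarith [mul_pos hb h3.1]
    · rcases hb.eq_or_lt with rfl | hb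
      · have : a = 1 := by linarith
        subst this
        norm_num at h2
      · nlinarith [mul_pos hb (sub_pos.2 h3.2)]

theorem ne_neg_nat_of_mem_cutPlane {s : ℂ} (hs : s ∈ cutPlane) (m : ℕ) : s ≠ -m := by
  rintro rfl
  exact hs ⟨by simp, by simp⟩

theorem cos_ne_zero_of_mem_cutPlane {s : ℂ} (hs : s ∈ cutPlane) :
    Complex.cos ((Real.pi : ℂ) * s / 2) ≠ 0 := by
  intro h
  obtain ⟨k, hk⟩ := Complex.cos_eq_zero_iff.1 h
  have hpi : (Real.pi : ℂ) ≠ 0 := Complex.ofReal_ne_zero.2 Real.pi_ne_zero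
  have h1 : s = ((2 * k + 1 : ℤ) : ℂ) := by
    push_cast
    apply mul_left_cancel₀ hpi
    linear_combination 2 * hk
  rw [h1] at hs
  apply hs
  refine ⟨Complex.intCast_im _, ?_⟩
  rw [Complex.intCast_re]
  rcases le_or_gt (2 * k + 1) 0 with h2 | h2
  · exact Or.inl (by exact_mod_cast h2)
  · exact Or.inr (by exact_mod_cast h2)

theorem two_pi_ne_zero_complex : (2 * (Real.pi : ℂ)) ≠ 0 :=
  mul_ne_zero two_ne_zero (Complex.ofReal_ne_zero.2 Real.pi_ne_zero)

theorem zetaChi_ne_zero {s : ℂ} (hs : s ∈ cutPlane) : zetaChi s ≠ 0 := by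
  refine div_ne_zero ?_ (mul_ne_zero (mul_ne_zero two_ne_zero
    (Complex.Gamma_ne_zero (ne_neg_nat_of_mem_cutPlane hs))) (cos_ne_zero_of_mem_cutPlane hs))
  rw [Complex.cpow_def_of_ne_zero two_pi_ne_zero_complex]
  exact Complex.exp_ne_zero _

theorem differentiableAt_zetaChi {s : ℂ} (hs : s ∈ cutPlane) : DifferentiableAt ℂ zetaChi s := by
  refine DifferentiableAt.div ?_ (((Complex.differentiableAt_Gamma s
    (ne_neg_nat_of_mem_cutPlane hs)).const_mul 2).mul ?_) (mul_ne_zero (mul_ne_zero two_ne_zero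
    (Complex.Gamma_ne_zero (ne_neg_nat_of_mem_cutPlane hs))) (cos_ne_zero_of_mem_cutPlane hs))
  · exact differentiableAt_id.const_cpow (Or.inl two_pi_ne_zero_complex)
  · fun_prop

theorem zetaChi_half : zetaChi (1 / 2) = 1 := by
  have h1 : (Real.pi : ℂ) * (1 / 2) / 2 = ((Real.pi / 4 : ℝ) : ℂ) := by push_cast; ring
  have h2 : (2 * (Real.pi : ℂ)) ^ (1 / 2 : ℂ) = ((√2 * √Real.pi : ℝ) : ℂ) := by
    rw [← Real.sqrt_mul (by norm_num), Real.sqrt_eq_rpow,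
      Complex.ofReal_cpow (by positivity)]
    push_cast
    rfl
  have h3 : Complex.Gamma (1 / 2) = ((√Real.pi : ℝ) : ℂ) := by
    rw [← Real.Gamma_one_half_eq, ← Complex.Gamma_ofReal]
    push_cast
    rfl
  have h4 : (√2 : ℝ) ≠ 0 := by positivity
  have h5 : √Real.pi ≠ 0 := (Real.sqrt_pos.2 Real.pi_pos).ne'
  rw [zetaChi, h1, h2, h3, ← Complex.ofReal_cos, Real.cos_pi_div_four]
  have : (√2 * √Real.pi) / (2 * √Real.pi * (√2 / 2)) = 1 := by field_simp
  exact_mod_cast this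

/-- The branch exists. -/
theorem exists_isLogChi : ∃ L : ℂ → ℂ, IsLogChi L := by
  have hsc : IsSimplyConnected cutPlane := by
    have := starConvex_cutPlane.contractibleSpace ⟨_, half_mem_cutPlane⟩
    rw [IsSimplyConnected]
    infer_instance
  obtain ⟨f, hf, hfe⟩ := Complex.exists_continuousOn_eqOn_exp_comp hsc isOpen_cutPlane
    (g := zetaChi) (fun s hs => (differentiableAt_zetaChi hs).continuousAt.continuousWithinAt)
    (by rintro ⟨s, hs, h⟩; exact zetaChi_ne_zero hs h)
  have hd : DifferentiableOn ℂ f cutPlane := by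
    intro s hs
    have hn : cutPlane ∈ nhds s := isOpen_cutPlane.mem_nhds hs
    have hc : Complex.exp ∘ f =ᶠ[nhds s] zetaChi := Filter.eventuallyEq_of_mem hn hfe
    exact (HasDerivAt.of_comp_left (hf.continuousAt hn) (Complex.hasDerivAt_exp _)
      (differentiableAt_zetaChi hs).hasDerivAt (Complex.exp_ne_zero _)
      hc).differentiableAt.differentiableWithinAt
  have h0 : Complex.exp (f (1 / 2)) = 1 := (hfe half_mem_cutPlane).trans zetaChi_half
  refine ⟨fun s => f s - f (1 / 2), hd.sub_const _, fun s hs => ?_, sub_self _⟩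
  rw [Complex.exp_sub, h0, div_one]
  exact hfe hs

/-- The branch is unique on the cut plane. -/
theorem IsLogChi.eqOn {L M : ℂ → ℂ} (hL : IsLogChi L) (hM : IsLogChi M) :
    Set.EqOn L M cutPlane := by
  have hd : ∀ {K : ℂ → ℂ}, IsLogChi K → ∀ s ∈ cutPlane,
      deriv K s = deriv zetaChi s / zetaChi s := by
    intro K hK s hs
    have hn : cutPlane ∈ nhds s := isOpen_cutPlane.mem_nhds hs
    have hc : (fun z => Complex.exp (K z)) =ᶠ[nhds s] zetaChi :=
      Filter.eventuallyEq_of_mem hn hK.2.1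
    have h1 := (hK.1.differentiableAt hn).hasDerivAt.cexp.congr_of_eventuallyEq hc.symm
    rw [h1.deriv, ← hK.2.1 s hs, mul_div_cancel_left₀ _ (Complex.exp_ne_zero _)]
  have hpc : IsPreconnected cutPlane :=
    (starConvex_cutPlane.isPathConnected half_mem_cutPlane).isConnected.isPreconnected
  exact isOpen_cutPlane.eqOn_of_deriv_eq hpc hL.1 hM.1
    (fun s hs => (hd hL s hs).trans (hd hM s hs).symm) half_mem_cutPlane
    (hL.2.2.trans hM.2.2.symm)

/-- The branch of `log χ(s)` on the cut plane that vanishes at `s = 1/2`. -/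
def logChi : ℂ → ℂ := Classical.choose exists_isLogChi

theorem isLogChi_logChi : IsLogChi logChi := Classical.choose_spec exists_isLogChi

/-- The Riemann–Siegel theta function `ϑ(t) = -(1/(2i)) log χ(1/2 + it)`, analytic on the complex
plane minus the cuts `i[1/2, ∞)` and `-i[1/2, ∞)`. -/
def riemannSiegelTheta (t : ℂ) : ℂ :=
  -(1 / (2 * Complex.I)) * logChi (1 / 2 + Complex.I * t)

end

noncomputable section

open Filter Topology

/-! The maps s ↦ 1 - s and s ↦ conj s send log χ to its negative and its conjugate
(`logChi_one_sub`, `logChi_conj`), so it suffices to treat Re s ≥ 1/2, Im s ≥ 1. There 2cos(πs/2) =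
e^{-πis/2}(1 + e^{πis}) and Stirling's formula give log χ(s) = (s - 1/2)(1 + log 2π + iπ/2 - log s)
+ O(1), of size T log T with T = |s - 1/2| = |t|; explicit constants leave room below 4T log T
(`norm_logChi_le`). Stirling's formula is derived from Gauss's product (`exp_logGammaBranch`). Its
additive constant stays in the form 1 - `stirlingRemainder 1` and need not be evaluated. The
explicit formula is identified with the normalised branch by a continuity argument starting at s =
1/2 (`logChi_eq_upperLogChi`). -/

/-! ### Stirling's series with an explicit remainder. -/

/-- The main part `(z - 1/2) log z - z` of Stirling's formula for `log Γ(z)`. -/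
def stirlingMain (z : ℂ) : ℂ := (z - 1 / 2) * Complex.log z - z

/-- The defect of `stirlingMain` in the equation `log Γ(z + 1) = log Γ(z) + log z`. -/
def stirlingDefect (z : ℂ) : ℂ := (z + 1 / 2) * (Complex.log (z + 1) - Complex.log z) - 1

/-- The remainder of Stirling's formula, up to an additive constant. -/
def stirlingRemainder (s : ℂ) : ℂ := ∑' k : ℕ, stirlingDefect (s + k)

/-- The branch of `log Γ` on the half plane `1/2 ≤ Re s` that is real on the real axis. -/
def logGammaBranch (s : ℂ) : ℂ :=
  stirlingMain s + stirlingRemainder s + 1 - stirlingRemainder 1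

theorem stirlingMain_add_one_sub (z : ℂ) :
    stirlingMain (z + 1) - stirlingMain z = Complex.log z + stirlingDefect z := by
  simp only [stirlingMain, stirlingDefect]; ring

/-- The defect is ∫₀¹ (1/2 - x)/(z + x) dx. Subtracting (1/2 - x)/(z + 1/2), whose integral
vanishes, leaves (1/2 - x)²/((z + x)(z + 1/2)), which has quadratic decay in z. -/
theorem norm_stirlingDefect_le {z : ℂ} (hz : 0 < z.re) :
    ‖stirlingDefect z‖ ≤ 1 / 4 / (‖z‖ * ‖z + 1 / 2‖) := by
  have hz0 : z ≠ 0 := by rintro rfl; simp at hz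
  have hzh : z + 1 / 2 ≠ 0 := by
    intro h
    have := congrArg Complex.re h
    norm_num at this
    linarith
  have hmem : ∀ x : ℝ, 0 ≤ x → z + x ∈ Complex.slitPlane := fun x hx =>
    Or.inl (by simp; linarith)
  have hd : ∀ x ∈ Set.Icc (0 : ℝ) 1, HasDerivWithinAt
      (fun x : ℝ => (z + 1 / 2) * Complex.log (z + x) - x - ((x : ℂ) - x ^ 2) / 2 / (z + 1 / 2))
      ((1 / 2 - (x : ℂ)) ^ 2 / ((z + x) * (z + 1 / 2))) (Set.Icc 0 1) x := by
    intro x hx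
    have hne : z + x ≠ 0 := Complex.slitPlane_ne_zero (hmem x hx.1)
    have h1 : HasDerivAt (fun w : ℂ => (z + 1 / 2) * Complex.log (z + w) - w
        - (w - w ^ 2) / 2 / (z + 1 / 2))
        ((z + 1 / 2) * (1 / (z + x)) - 1 - (1 - 2 * x) / 2 / (z + 1 / 2)) (x : ℂ) := by
      have h2 := (((hasDerivAt_id (x : ℂ)).const_add z).clog (hmem x hx.1)).const_mul (z + 1 / 2)
      have h3 := (((hasDerivAt_id (x : ℂ)).sub ((hasDerivAt_id (x : ℂ)).pow 2)).div_const
        2).div_const (z + 1 / 2)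
      refine ((h2.sub (hasDerivAt_id (x : ℂ))).sub h3).congr_deriv ?_
      simp
    refine (h1.comp_ofReal.congr_deriv ?_).hasDerivWithinAt
    have hzh' : z * 2 + 1 ≠ 0 := fun h => hzh (by linear_combination h / 2)
    field_simp
    ring
  have hb := norm_image_sub_le_of_norm_deriv_le_segment_01' (C := 1 / 4 / (‖z‖ * ‖z + 1 / 2‖)) hd ?_
  · refine le_of_eq_of_le ?_ hb
    congr 1
    simp [stirlingDefect]
    ring
  · intro x hx
    have h1 : ‖(1 / 2 - (x : ℂ)) ^ 2‖ ≤ 1 / 4 := by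
      have : (1 / 2 - (x : ℂ)) ^ 2 = (((1 / 2 - x) ^ 2 : ℝ) : ℂ) := by push_cast; ring
      rw [this, Complex.norm_real, Real.norm_of_nonneg (sq_nonneg _)]
      nlinarith [hx.1, hx.2]
    have h2 : ‖z‖ ≤ ‖z + x‖ := by
      rw [← sq_le_sq₀ (norm_nonneg _) (norm_nonneg _), Complex.sq_norm, Complex.sq_norm,
        Complex.normSq_apply, Complex.normSq_apply]
      simp
      nlinarith [hx.1, mul_nonneg hz.le hx.1]
    rw [norm_div, norm_mul]
    gcongr

/-- The terms `1 / (4 (k + 1/4) (k + 5/4))` dominating the series `stirlingRemainder`. -/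
def defectBound (k : ℕ) : ℝ := 1 / 4 / ((k + 1 / 4) * (k + 5 / 4))

theorem hasSum_defectBound : HasSum defectBound 1 := by
  refine (hasSum_iff_tendsto_nat_of_nonneg (fun k => by unfold defectBound; positivity) 1).2 ?_
  -- The two factors differ by 1, so partial fractions telescope.
  have h : ∀ n : ℕ, ∑ i ∈ Finset.range n, defectBound i = 1 - 1 / 4 * ((n : ℝ) + 1 / 4)⁻¹ := by
    intro n
    induction n with
    | zero => norm_num
    | succ n ih =>
      rw [Finset.sum_range_succ, ih, defectBound]
      push_cast
      field_simp
      ring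
  simp_rw [h]
  have h2 : Tendsto (fun n : ℕ => ((n : ℝ) + 1 / 4)⁻¹) atTop (𝓝 0) :=
    (tendsto_atTop_add_const_right _ _ tendsto_natCast_atTop_atTop).inv_tendsto_atTop
  have h3 := (h2.const_mul (1 / 4)).const_sub 1
  rwa [mul_zero, sub_zero] at h3

theorem norm_stirlingDefect_add_nat_le {s : ℂ} (hs : 1 / 2 ≤ s.re) (k : ℕ) :
    ‖stirlingDefect (s + k)‖ ≤ defectBound k := by
  have hk : (0 : ℝ) ≤ k := k.cast_nonneg
  refine (norm_stirlingDefect_le (by simp; linarith)).trans ?_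
  have h1 : (k : ℝ) + 1 / 2 ≤ ‖s + k‖ := by
    refine le_trans ?_ (Complex.re_le_norm _)
    simp; linarith
  have h2 : (k : ℝ) + 1 ≤ ‖s + k + 1 / 2‖ := by
    refine le_trans ?_ (Complex.re_le_norm _)
    norm_num; linarith
  rw [defectBound]
  have h3 := mul_le_mul h1 h2 (by positivity) (norm_nonneg _)
  refine div_le_div_of_nonneg_left (by norm_num) (by positivity) ?_
  nlinarith

theorem hasSum_stirlingRemainder {s : ℂ} (hs : 1 / 2 ≤ s.re) :
    HasSum (fun k : ℕ => stirlingDefect (s + k)) (stirlingRemainder s) :=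
  (Summable.of_norm_bounded hasSum_defectBound.summable
    (norm_stirlingDefect_add_nat_le hs)).hasSum

theorem norm_stirlingRemainder_le {s : ℂ} (hs : 1 / 2 ≤ s.re) : ‖stirlingRemainder s‖ ≤ 1 :=
  tsum_of_norm_bounded hasSum_defectBound (norm_stirlingDefect_add_nat_le hs)

theorem continuousOn_logGammaBranch : ContinuousOn logGammaBranch {s | 1 / 2 ≤ s.re} := by
  have hm : ∀ k : ℕ, ∀ s ∈ {s : ℂ | 1 / 2 ≤ s.re}, s + k ∈ Complex.slitPlane := fun k s hs => by
    have hk : (0 : ℝ) ≤ k := k.cast_nonneg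
    have hs : 1 / 2 ≤ s.re := hs
    exact Or.inl (by simp; linarith)
  have h1 : ContinuousOn stirlingRemainder {s | 1 / 2 ≤ s.re} := by
    refine continuousOn_tsum (fun k => ?_) hasSum_defectBound.summable
      fun k s hs => norm_stirlingDefect_add_nat_le hs k
    have h2 : ContinuousOn (fun s : ℂ => Complex.log (s + k + 1)) {s | 1 / 2 ≤ s.re} :=
      ContinuousOn.clog (by fun_prop) fun s hs => by
        simpa [add_assoc] using hm (k + 1) s hs
    have h3 : ContinuousOn (fun s : ℂ => Complex.log (s + k)) {s | 1 / 2 ≤ s.re} :=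
      ContinuousOn.clog (by fun_prop) (hm k)
    unfold stirlingDefect
    fun_prop
  have h4 : ContinuousOn (fun s : ℂ => Complex.log s) {s | 1 / 2 ≤ s.re} :=
    ContinuousOn.clog (by fun_prop) fun s hs => by simpa using hm 0 s hs
  unfold logGammaBranch stirlingMain
  fun_prop

/-! ### Gauss's product and the logarithm of Γ. -/

theorem sum_log_add_nat (s : ℂ) (n : ℕ) :
    ∑ j ∈ Finset.range n, Complex.log (s + j) =
      stirlingMain (s + n) - stirlingMain s - ∑ j ∈ Finset.range n, stirlingDefect (s + j) := by
  induction n with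
  | zero => simp
  | succ n ih =>
    rw [Finset.sum_range_succ, Finset.sum_range_succ, ih]
    have := stirlingMain_add_one_sub (s + n)
    push_cast
    rw [← add_assoc]
    linear_combination -this

theorem exp_sum_log_add_nat {s : ℂ} (hs : 0 < s.re) (n : ℕ) :
    Complex.exp (∑ j ∈ Finset.range n, Complex.log (s + j)) = ∏ j ∈ Finset.range n, (s + j) := by
  rw [Complex.exp_sum]
  refine Finset.prod_congr rfl fun j _ => Complex.exp_log fun h => ?_
  have := congrArg Complex.re h
  have hj : (0 : ℝ) ≤ j := j.cast_nonneg
  simp at this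
  linarith

/-- These are the terms of the logarithm of Gauss's product that depend on n, apart from the defect
sums. After the logarithms of n cancel, only m log(1 + s/m) → s and vanishing terms remain. -/
theorem tendsto_stirlingMain_sub (s : ℂ) (hs : 0 < s.re) :
    Tendsto (fun n : ℕ => s * Complex.log n + stirlingMain (1 + n) - stirlingMain (s + (n + 1 : ℕ)))
      atTop (𝓝 0) := by
  have hnat : Tendsto (fun n : ℕ => n * Complex.log (1 + s / n)) atTop (𝓝 s) :=
    Complex.tendsto_nat_mul_log_one_add_of_tendsto <| by
      refine tendsto_const_nhds.congr' ?_
      filter_upwards [eventually_ne_atTop 0] with n hn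
      field_simp
  have hinv : Tendsto (fun n : ℕ => (n : ℂ)⁻¹) atTop (𝓝 0) := tendsto_inv_atTop_nhds_zero_nat
  have hlog : ∀ w : ℂ, Tendsto (fun n : ℕ => Complex.log (1 + w / n)) atTop (𝓝 0) := fun w => by
    have h1 : Tendsto (fun n : ℕ => 1 + w / n) atTop (𝓝 1) := by
      simpa [div_eq_mul_inv] using (hinv.const_mul w).const_add 1
    simpa using h1.clog Complex.one_mem_slitPlane
  have hmain := ((tendsto_add_atTop_iff_nat 1).2
    ((hnat.const_sub s).sub ((hlog s).const_mul (s - 1 / 2)))).sub ((hlog 1).const_mul s)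
  simp only [sub_self, mul_zero] at hmain
  refine hmain.congr' ?_
  filter_upwards [eventually_gt_atTop 0] with n hn
  have hn' : (0 : ℝ) < n := by exact_mod_cast hn
  have hnc : (n : ℂ) ≠ 0 := by exact_mod_cast hn.ne'
  have hnc1 : (n : ℂ) + 1 ≠ 0 := by exact_mod_cast n.succ_ne_zero
  have h1 : Complex.log (1 + n) = Complex.log n + Complex.log (1 + 1 / n) := by
    have hne : (1 + 1 / n : ℂ) ≠ 0 := by
      rw [one_add_div hnc]
      exact div_ne_zero hnc1 hnc
    have := Complex.log_ofReal_mul hn' hne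
    rw [Complex.ofReal_log hn'.le] at this
    push_cast at this
    rw [← this]
    congr 1
    field_simp
    ring
  have h2 : Complex.log (s + (n + 1 : ℕ)) = Complex.log (1 + n)
      + Complex.log (1 + s / (n + 1 : ℕ)) := by
    have hne : (1 + s / (n + 1 : ℕ) : ℂ) ≠ 0 := by
      push_cast
      rw [one_add_div hnc1]
      refine div_ne_zero (fun h => ?_) hnc1
      have := congrArg Complex.re h
      simp at this
      linarith
    have := Complex.log_ofReal_mul (by linarith : (0 : ℝ) < 1 + n) hne
    rw [Complex.ofReal_log (by linarith)] at this
    push_cast at this ⊢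
    rw [← this]
    congr 1
    field_simp
    ring
  simp only [stirlingMain]
  rw [h2, h1]
  push_cast
  ring

theorem exp_logGammaBranch {s : ℂ} (hs : 1 / 2 ≤ s.re) :
    Complex.exp (logGammaBranch s) = Complex.Gamma s := by
  have hs0 : 0 < s.re := by linarith
  have h1 := (hasSum_stirlingRemainder hs).tendsto_sum_nat
  have h2 := (hasSum_stirlingRemainder (s := 1) (by norm_num)).tendsto_sum_nat
  -- Gauss's quotient has n + 1 factors s + j against n factors of n!, so only the series at s is
  -- shifted by one.
  have h3 := (((tendsto_stirlingMain_sub s hs0).add_const (stirlingMain s + 1)).add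
    ((tendsto_add_atTop_iff_nat 1).2 h1)).sub h2
  have h4 : 0 + (stirlingMain s + 1) + stirlingRemainder s - stirlingRemainder 1
      = logGammaBranch s := by unfold logGammaBranch; ring
  rw [h4] at h3
  refine tendsto_nhds_unique (((Complex.continuous_exp.tendsto _).comp h3).congr' ?_)
    (Complex.GammaSeq_tendsto_Gamma s)
  filter_upwards [eventually_gt_atTop 0] with n hn
  have hnc : (n : ℂ) ≠ 0 := by exact_mod_cast hn.ne'
  have hfac : (n.factorial : ℂ) = ∏ j ∈ Finset.range n, (1 + j : ℂ) := by
    rw [← Finset.prod_range_add_one_eq_factorial]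
    push_cast
    simp_rw [add_comm]
  have hone : stirlingMain 1 = -1 := by simp [stirlingMain]
  rw [Complex.GammaSeq, hfac, ← exp_sum_log_add_nat (by simp), ← exp_sum_log_add_nat hs0,
    Complex.cpow_def_of_ne_zero hnc, ← Complex.exp_add, ← Complex.exp_sub, sum_log_add_nat,
    sum_log_add_nat, hone, Function.comp_apply]
  congr 1
  ring

/-- Serves to exclude a multiple of 2πi at the base point s = 1/2. -/
theorem logGammaBranch_half_im : (logGammaBranch (1 / 2)).im = 0 := by
  have hd : ∀ x : ℝ, 0 ≤ x → (stirlingDefect x).im = 0 := fun x hx => by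
    have : stirlingDefect x = (((x + 1 / 2) * (Real.log (x + 1) - Real.log x) - 1 : ℝ) : ℂ) := by
      unfold stirlingDefect
      push_cast [Complex.ofReal_log hx, Complex.ofReal_log (by linarith : 0 ≤ x + 1)]
      ring
    rw [this, Complex.ofReal_im]
  have hR : ∀ x : ℝ, 1 / 2 ≤ x → (stirlingRemainder x).im = 0 := fun x hx => by
    have h := (hasSum_stirlingRemainder (s := x) (by simpa using hx)).mapL Complex.imCLM
    refine h.unique ?_
    convert hasSum_zero with k
    have hk : (0 : ℝ) ≤ k := k.cast_nonneg
    simpa using hd (x + k) (by linarith)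
  have h1 := hR (1 / 2) le_rfl
  have h2 := hR 1 (by norm_num)
  push_cast at h1 h2
  rw [logGammaBranch, Complex.sub_im, Complex.add_im, Complex.add_im, h1, h2, stirlingMain,
    sub_self, zero_mul]
  simp


/-! ### An explicit branch of log χ in the quadrant. -/

/-- The branch of `log χ` in the upper half plane obtained from
`2 cos (πs/2) = exp (-πis/2) (1 + exp (πis))`. -/
def upperLogChi (s : ℂ) : ℂ :=
  s * Complex.log (2 * (Real.pi : ℂ)) + Complex.I * Real.pi * s / 2
    - Complex.log (1 + Complex.exp (Complex.I * Real.pi * s)) - logGammaBranch s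

/-- The part of the upper half plane to the right of the critical line, with the point `1/2`. -/
def upperQuadrant : Set ℂ := {s | 1 / 2 ≤ s.re ∧ (0 < s.im ∨ s = 1 / 2)}

theorem half_mem_upperQuadrant : (1 / 2 : ℂ) ∈ upperQuadrant := ⟨by norm_num, Or.inr rfl⟩

theorem upperQuadrant_subset_cutPlane : upperQuadrant ⊆ cutPlane := by
  rintro s ⟨-, h | rfl⟩
  · exact fun h' => h.ne' h'.1
  · exact half_mem_cutPlane

theorem isPreconnected_upperQuadrant : IsPreconnected upperQuadrant := by
  have h : StarConvex ℝ (1 / 2 : ℂ) upperQuadrant := by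
    rintro s ⟨hre, him⟩ a b ha hb hab
    refine ⟨?_, ?_⟩
    · simp
      nlinarith
    · rcases hb.eq_or_lt with rfl | hb
      · right
        have : a = 1 := by linarith
        simp [this]
      · rcases him with him | rfl
        · left
          simpa using mul_pos hb him
        · right
          rw [← add_smul, hab, one_smul]
  exact (h.isPathConnected half_mem_upperQuadrant).isConnected.isPreconnected

theorem norm_exp_I_mul_pi_mul (s : ℂ) :
    ‖Complex.exp (Complex.I * Real.pi * s)‖ = Real.exp (-(Real.pi * s.im)) := by
  rw [Complex.norm_exp]
  simp

theorem exp_I_mul_pi_mul_half : Complex.exp (Complex.I * Real.pi * (1 / 2)) = Complex.I := by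
  rw [show Complex.I * Real.pi * (1 / 2) = (Real.pi : ℂ) / 2 * Complex.I by ring,
    Complex.exp_pi_div_two_mul_I]

theorem one_add_exp_mem_slitPlane {s : ℂ} (hs : s ∈ upperQuadrant) :
    1 + Complex.exp (Complex.I * Real.pi * s) ∈ Complex.slitPlane := by
  left
  rcases hs.2 with h | rfl
  · have h1 := (abs_le.1 (Complex.abs_re_le_norm (Complex.exp (Complex.I * Real.pi * s)))).1
    rw [norm_exp_I_mul_pi_mul] at h1
    have h2 : Real.exp (-(Real.pi * s.im)) < 1 :=
      by simpa using mul_pos Real.pi_pos h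
    rw [Complex.add_re, Complex.one_re]
    linarith
  · rw [exp_I_mul_pi_mul_half]
    simp

theorem continuousOn_upperLogChi : ContinuousOn upperLogChi upperQuadrant := by
  have h1 : ContinuousOn logGammaBranch upperQuadrant :=
    continuousOn_logGammaBranch.mono fun s hs => hs.1
  have h2 : ContinuousOn (fun s : ℂ => Complex.log (1 + Complex.exp (Complex.I * Real.pi * s)))
      upperQuadrant :=
    ContinuousOn.clog (by fun_prop) fun s hs => one_add_exp_mem_slitPlane hs
  unfold upperLogChi
  fun_prop

theorem exp_upperLogChi {s : ℂ} (hs : s ∈ upperQuadrant) :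
    Complex.exp (upperLogChi s) = zetaChi s := by
  have hne := Complex.slitPlane_ne_zero (one_add_exp_mem_slitPlane hs)
  have hE := Complex.exp_ne_zero (Complex.I * Real.pi * s / 2)
  have hsq : Complex.exp (Complex.I * Real.pi * s) =
      Complex.exp (Complex.I * Real.pi * s / 2) ^ 2 := by
    rw [← Complex.exp_nat_mul]
    congr 1
    push_cast
    ring
  have hcos : 2 * Complex.cos (Real.pi * s / 2) = (Complex.exp (Complex.I * Real.pi * s / 2))⁻¹
      * (1 + Complex.exp (Complex.I * Real.pi * s)) := by
    rw [Complex.two_cos, hsq, ← Complex.exp_neg,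
      show (Real.pi * s / 2 : ℂ) * Complex.I = Complex.I * Real.pi * s / 2 by ring,
      show -(Real.pi * s / 2 : ℂ) * Complex.I = -(Complex.I * Real.pi * s / 2) by ring,
      Complex.exp_neg]
    field_simp
    ring
  have hG : Complex.Gamma s ≠ 0 := by
    rw [← exp_logGammaBranch hs.1]
    exact Complex.exp_ne_zero _
  rw [zetaChi, mul_right_comm, hcos, upperLogChi, Complex.exp_sub, Complex.exp_sub, Complex.exp_add,
    Complex.exp_log hne, exp_logGammaBranch hs.1,
    Complex.cpow_def_of_ne_zero two_pi_ne_zero_complex, mul_comm s]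
  field_simp

/-- The imaginary part π/4 of iπs/2 cancels arg(1 + i), so the value is real, and its exponential is
χ(1/2) = 1. -/
theorem upperLogChi_half : upperLogChi (1 / 2) = 0 := by
  have him : (upperLogChi (1 / 2)).im = 0 := by
    have h1 : (Complex.log (2 * (Real.pi : ℂ))).im = 0 := by
      have := congrArg Complex.im (Complex.ofReal_log (x := 2 * Real.pi) (by positivity))
      push_cast at this
      simpa using this.symm
    have h2 : (Complex.log (1 + Complex.I)).im = Real.pi / 4 := by
      have h3 : (1 + Complex.I : ℂ) = ((√2 : ℝ) : ℂ) * (Real.cos (Real.pi / 4)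
          + Real.sin (Real.pi / 4) * Complex.I : ℂ) := by
        rw [Real.cos_pi_div_four, Real.sin_pi_div_four]
        have : ((√2 : ℝ) : ℂ) * ((√2 : ℝ) : ℂ) = 2 := by
          rw [← Complex.ofReal_mul, Real.mul_self_sqrt (by norm_num)]
          norm_num
        push_cast
        linear_combination (-1 / 2 - Complex.I / 2) * this
      rw [Complex.log_im, h3]
      push_cast
      have := Complex.arg_mul_cos_add_sin_mul_I (r := √2) (θ := Real.pi / 4) (by positivity)
        ⟨by linarith [Real.pi_pos], by linarith [Real.pi_pos]⟩
      push_cast at this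
      exact this
    have h4 : ((1 / 2 : ℂ) * Complex.log (2 * (Real.pi : ℂ))).im = 0 := by
      rw [Complex.mul_im, h1]
      norm_num
    have h5 : (Complex.I * Real.pi * (1 / 2) / 2 : ℂ).im = Real.pi / 4 := by
      rw [show (Complex.I * Real.pi * (1 / 2) / 2 : ℂ) = ((Real.pi / 4 : ℝ) : ℂ) * Complex.I by
        push_cast; ring]
      simp
    rw [upperLogChi, exp_I_mul_pi_mul_half, Complex.sub_im, Complex.sub_im, Complex.add_im, h4, h5,
      h2, logGammaBranch_half_im]
    ring
  have hexp := exp_upperLogChi half_mem_upperQuadrant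
  rw [zetaChi_half] at hexp
  obtain ⟨x, hx⟩ : ∃ x : ℝ, upperLogChi (1 / 2) = x :=
    ⟨(upperLogChi (1 / 2)).re, Complex.ext rfl (by simpa using him)⟩
  rw [hx, ← Complex.ofReal_exp, Complex.ofReal_eq_one, Real.exp_eq_one_iff] at hexp
  rw [hx, hexp, Complex.ofReal_zero]

/-- The difference divided by 2πi is continuous and integer-valued on a connected set containing
1/2, where it vanishes. Only continuity of the explicit branch is needed. -/
theorem logChi_eq_upperLogChi {s : ℂ} (hs : s ∈ upperQuadrant) : logChi s = upperLogChi s := by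
  obtain ⟨hd, hexp, h0⟩ := isLogChi_logChi
  have hI : (2 * Real.pi * Complex.I : ℂ) ≠ 0 := Complex.two_pi_I_ne_zero
  have hint : ∀ z ∈ upperQuadrant,
      ∃ n : ℤ, logChi z - upperLogChi z = n * (2 * Real.pi * Complex.I) := fun z hz => by
    rw [← Complex.exp_eq_one_iff, Complex.exp_sub, exp_upperLogChi hz,
      hexp z (upperQuadrant_subset_cutPlane hz),
      div_self (zetaChi_ne_zero (upperQuadrant_subset_cutPlane hz))]
  have hc : ContinuousOn
      (fun z => ((logChi z - upperLogChi z) / (2 * Real.pi * Complex.I)).re) upperQuadrant :=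
    Complex.continuous_re.comp_continuousOn
      (((hd.continuousOn.mono upperQuadrant_subset_cutPlane).sub
        continuousOn_upperLogChi).div_const _)
  have hmaps : Set.MapsTo (fun z => ((logChi z - upperLogChi z) / (2 * Real.pi * Complex.I)).re)
      upperQuadrant (Set.range ((↑) : ℤ → ℝ)) := fun z hz => by
    obtain ⟨n, hn⟩ := hint z hz
    exact ⟨n, by simp only [hn, mul_div_cancel_right₀ _ hI, Complex.intCast_re]⟩
  have heq := isPreconnected_upperQuadrant.constant_of_mapsTo
    Int.isClosedEmbedding_coe_real.isEmbedding.isDiscrete_range hc hmaps hs half_mem_upperQuadrant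
  obtain ⟨n, hn⟩ := hint s hs
  simp only [h0, upperLogChi_half, hn, mul_div_cancel_right₀ _ hI, Complex.intCast_re, sub_self,
    zero_div, Complex.zero_re, Int.cast_eq_zero] at heq
  rw [heq, Int.cast_zero, zero_mul] at hn
  exact sub_eq_zero.1 hn

/-! ### Symmetries of χ and of its logarithm. -/

theorem zetaChi_one_sub {s : ℂ} (hs : s ∈ cutPlane) (hs' : 1 - s ∈ cutPlane) :
    zetaChi (1 - s) = (zetaChi s)⁻¹ := by
  refine eq_inv_of_mul_eq_one_left ?_
  have hc := cos_ne_zero_of_mem_cutPlane hs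
  have hc' := cos_ne_zero_of_mem_cutPlane hs'
  have hsin : Complex.cos (Real.pi * (1 - s) / 2) = Complex.sin (Real.pi * s / 2) := by
    rw [← Complex.cos_pi_div_two_sub]
    congr 1
    ring
  rw [hsin] at hc'
  have hG := Complex.Gamma_mul_Gamma_one_sub s
  rw [show (Real.pi * s : ℂ) = 2 * (Real.pi * s / 2) by ring, Complex.sin_two_mul] at hG
  have hpi : (Real.pi : ℂ) ≠ 0 := Complex.ofReal_ne_zero.2 Real.pi_ne_zero
  have hpow : (2 * (Real.pi : ℂ)) ^ (1 - s) * (2 * (Real.pi : ℂ)) ^ s = 2 * Real.pi := by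
    rw [← Complex.cpow_add _ _ two_pi_ne_zero_complex]
    simp
  rw [zetaChi, zetaChi, hsin, div_mul_div_comm, hpow,
    show 2 * Complex.Gamma (1 - s) * Complex.sin (Real.pi * s / 2)
      * (2 * Complex.Gamma s * Complex.cos (Real.pi * s / 2)) =
      4 * (Complex.Gamma s * Complex.Gamma (1 - s)) * (Complex.sin (Real.pi * s / 2)
        * Complex.cos (Real.pi * s / 2)) by ring, hG]
  field_simp
  norm_num

theorem one_sub_mem_cutPlane {s : ℂ} (hs : s ∈ cutPlane) : 1 - s ∈ cutPlane := by
  rintro ⟨h1, h2⟩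
  simp at h1 h2
  exact hs ⟨h1, h2.symm⟩

theorem conj_mem_cutPlane {s : ℂ} (hs : s ∈ cutPlane) : starRingEnd ℂ s ∈ cutPlane := by
  rintro ⟨h1, h2⟩
  simp at h1 h2
  exact hs ⟨h1, h2⟩

/-- By uniqueness of the branch, since χ(s)χ(1 - s) = 1 and 1/2 is fixed by s ↦ 1 - s. -/
theorem logChi_one_sub {s : ℂ} (hs : s ∈ cutPlane) : logChi (1 - s) = -logChi s := by
  obtain ⟨hd, hexp, h0⟩ := isLogChi_logChi
  have h : IsLogChi fun z => -logChi (1 - z) := by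
    refine ⟨(hd.comp (by fun_prop) fun z hz => one_sub_mem_cutPlane hz).neg, fun z hz => ?_, ?_⟩
    · rw [Complex.exp_neg, hexp _ (one_sub_mem_cutPlane hz),
        zetaChi_one_sub hz (one_sub_mem_cutPlane hz), inv_inv]
    · beta_reduce
      rw [show (1 - 1 / 2 : ℂ) = 1 / 2 by norm_num, h0, neg_zero]
  rw [isLogChi_logChi.eqOn h hs, neg_neg]

theorem zetaChi_conj (s : ℂ) : zetaChi (starRingEnd ℂ s) = starRingEnd ℂ (zetaChi s) := by
  have h2 : starRingEnd ℂ (2 * (Real.pi : ℂ)) = 2 * Real.pi := by simp [map_ofNat]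
  have harg : (2 * (Real.pi : ℂ)).arg ≠ Real.pi := by
    have := Complex.arg_ofReal_of_nonneg (x := 2 * Real.pi) (by positivity)
    push_cast at this
    rw [this]
    exact Real.pi_ne_zero.symm
  have hcos : (Real.pi : ℂ) * starRingEnd ℂ s / 2 = starRingEnd ℂ (Real.pi * s / 2) := by
    simp [map_ofNat]
  rw [zetaChi, zetaChi, Complex.cpow_conj _ _ harg, h2, Complex.Gamma_conj, hcos, Complex.cos_conj]
  simp [map_ofNat]

theorem logChi_conj {s : ℂ} (hs : s ∈ cutPlane) :
    logChi (starRingEnd ℂ s) = starRingEnd ℂ (logChi s) := by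
  obtain ⟨hd, hexp, h0⟩ := isLogChi_logChi
  have h : IsLogChi fun z => starRingEnd ℂ (logChi (starRingEnd ℂ z)) := by
    refine ⟨fun z hz => ?_, fun z hz => ?_, ?_⟩
    · have h1 := (hd.differentiableAt (isOpen_cutPlane.mem_nhds (conj_mem_cutPlane hz))).conj_conj
      rw [Complex.conj_conj] at h1
      exact h1.differentiableWithinAt
    · rw [Complex.exp_conj, hexp _ (conj_mem_cutPlane hz), ← zetaChi_conj, Complex.conj_conj]
    · beta_reduce
      rw [show starRingEnd ℂ (1 / 2 : ℂ) = 1 / 2 by simp [map_ofNat], h0, map_zero]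
  rw [isLogChi_logChi.eqOn h hs, Complex.conj_conj]

/-! ### The explicit bound. -/

theorem norm_logChi_le {s : ℂ} (hre : 1 / 2 ≤ s.re) (him : 1 ≤ s.im) (hs : 4 ≤ ‖s - 1 / 2‖) :
    ‖logChi s‖ ≤ 4 * ‖s - 1 / 2‖ * Real.log ‖s - 1 / 2‖ := by
  have hpi := Real.pi_gt_d2
  have hpi' := Real.pi_lt_d2
  have hlog2 := Real.log_two_gt_d9
  have hlog2' := Real.log_two_lt_d9
  set T := ‖s - 1 / 2‖ with hT
  set E := Complex.log (1 + Complex.exp (Complex.I * Real.pi * s)) with hE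
  set A : ℂ := 1 + Complex.log (2 * (Real.pi : ℂ)) + Complex.I * Real.pi / 2 with hA
  -- Im s ≥ 1 keeps s away from the odd integers, the zeros of 1 + e^{πis}.
  have hE1 : ‖E‖ ≤ 1 := by
    have h1 : ‖Complex.exp (Complex.I * Real.pi * s)‖ ≤ 1 / 2 := by
      rw [norm_exp_I_mul_pi_mul, Real.exp_neg, one_div]
      refine inv_anti₀ (by norm_num) ?_
      nlinarith [Real.add_one_le_exp (Real.pi * s.im)]
    have h2 := Complex.norm_log_one_add_half_le_self h1
    linarith
  have hlogpi : Complex.log (2 * (Real.pi : ℂ)) = (Real.log (2 * Real.pi) : ℝ) := by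
    rw [Complex.ofReal_log (by positivity)]
    push_cast
    rfl
  have hlp : 1 ≤ Real.log (2 * Real.pi) := by
    rw [Real.le_log_iff_exp_le (by positivity)]
    linarith [Real.exp_one_lt_d9]
  have hlp' : Real.log (2 * Real.pi) ≤ 2 := by
    rw [Real.log_le_iff_le_exp (by positivity)]
    have h1 : Real.exp 2 = Real.exp 1 * Real.exp 1 := by rw [← Real.exp_add]; norm_num
    nlinarith [Real.exp_one_gt_d9]
  have hlog4 : Real.log 4 = 2 * Real.log 2 := by
    rw [show (4 : ℝ) = 2 ^ 2 by norm_num, Real.log_pow]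
    norm_num
  have hT0 : 0 < T := by linarith
  have hlogT : 1.38 ≤ Real.log T := by
    have := Real.log_le_log (by norm_num) hs
    linarith
  have hTs : T ≤ ‖s‖ := by
    rw [hT, ← sq_le_sq₀ (norm_nonneg _) (norm_nonneg _), Complex.sq_norm, Complex.sq_norm,
      Complex.normSq_apply, Complex.normSq_apply]
    norm_num
    nlinarith
  have hsT : ‖s‖ ≤ T * (9 / 8) := by
    have h1 : ‖s‖ ≤ T + 1 / 2 := by
      have := norm_add_le (s - 1 / 2) (1 / 2)
      norm_num at this
      linarith
    linarith
  have hlogs : Real.log T ≤ Real.log ‖s‖ := Real.log_le_log hT0 hTs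
  have hlogs' : Real.log ‖s‖ ≤ Real.log T + 1 / 8 := by
    have h1 := Real.log_le_log (by linarith) hsT
    rw [Real.log_mul hT0.ne' (by norm_num)] at h1
    have := Real.log_le_sub_one_of_pos (x := 9 / 8) (by norm_num)
    linarith
  have hmain : ‖A - Complex.log s‖ ≤ Real.log T + 2 := by
    refine (Complex.norm_le_abs_re_add_abs_im _).trans ?_
    have h1 : (A - Complex.log s).re = 1 + Real.log (2 * Real.pi) - Real.log ‖s‖ := by
      rw [hA, hlogpi]
      simp [Complex.log_re]
    have h2 : (A - Complex.log s).im = Real.pi / 2 - s.arg := by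
      rw [hA, hlogpi]
      simp [Complex.log_im]
    -- In the first quadrant 0 ≤ arg s ≤ π/2.
    have h3 : |Real.pi / 2 - s.arg| ≤ Real.pi / 2 := by
      have h4 := Complex.arg_nonneg_iff.2 (by linarith : 0 ≤ s.im)
      have h5 := (abs_le.1 (Complex.abs_arg_le_pi_div_two_iff.2 (by linarith : 0 ≤ s.re))).2
      rw [abs_le]
      constructor <;> linarith
    have h4 : |1 + Real.log (2 * Real.pi) - Real.log ‖s‖| ≤ Real.log T + 0.3 := by
      rw [abs_le]
      constructor <;> linarith
    rw [h1, h2]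
    linarith
  have hAn : ‖A‖ ≤ 5 := by
    have h1 : ‖Complex.I * (Real.pi : ℂ) / 2‖ = Real.pi / 2 := by
      simp [abs_of_pos Real.pi_pos]
    have h2 : ‖(1 : ℂ) + (Real.log (2 * Real.pi) : ℝ)‖ = 1 + Real.log (2 * Real.pi) := by
      rw [← Complex.ofReal_one, ← Complex.ofReal_add, Complex.norm_real,
        Real.norm_of_nonneg (by linarith)]
    rw [hA, hlogpi]
    refine (norm_add_le _ _).trans ?_
    rw [h1, h2]
    linarith
  have hR1 := norm_stirlingRemainder_le hre
  have hR2 := norm_stirlingRemainder_le (s := 1) (by norm_num)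
  have hform : logChi s = (s - 1 / 2) * (A - Complex.log s) + 1 / 2 * A - E - stirlingRemainder s
      - 1 + stirlingRemainder 1 := by
    rw [logChi_eq_upperLogChi ⟨hre, Or.inl (by linarith)⟩, upperLogChi, logGammaBranch, stirlingMain,
      ← hE, hA]
    ring
  have hb : ‖logChi s‖ ≤ T * (Real.log T + 2) + 1 / 2 * 5 + 1 + 1 + 1 + 1 := by
    rw [hform]
    refine (norm_add_le _ _).trans (add_le_add ?_ hR2)
    refine (norm_sub_le _ _).trans (add_le_add ?_ (by simp))
    refine (norm_sub_le _ _).trans (add_le_add ?_ hR1)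
    refine (norm_sub_le _ _).trans (add_le_add ?_ hE1)
    refine (norm_add_le _ _).trans (add_le_add ?_ ?_)
    · rw [norm_mul]
      gcongr
    · rw [norm_mul]
      norm_num
      linarith
  -- It remains to see 2T + 6.5 ≤ 3T log T, which holds since log T ≥ 1.38 and T ≥ 4.
  nlinarith [mul_le_mul_of_nonneg_left hlogT hT0.le]

theorem mainTheorem6 (t : ℂ) (ht : 4 ≤ ‖t‖) (hre : 1 ≤ |t.re|) :
    ‖riemannSiegelTheta t‖ ≤ 2 * ‖t‖ * Real.log ‖t‖ := by
  set s : ℂ := 1 / 2 + Complex.I * t with hs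
  have hsre : s.re = 1 / 2 - t.im := by rw [hs]; norm_num; ring
  have hsim : s.im = t.re := by rw [hs]; norm_num
  have hcut : s ∈ cutPlane := fun h => by
    rw [← hsim, h.1] at hre
    norm_num at hre
  have hnorm : ‖s - 1 / 2‖ = ‖t‖ := by rw [hs]; simp
  have hconj : ∀ z : ℂ, ‖starRingEnd ℂ z - 1 / 2‖ = ‖z - 1 / 2‖ := fun z => by
    rw [← Complex.norm_conj (z - 1 / 2)]
    simp [map_ofNat]
  have hsub : ∀ z : ℂ, ‖1 - z - 1 / 2‖ = ‖z - 1 / 2‖ := fun z => by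
    rw [← norm_neg]
    congr 1
    ring
  have key : ‖logChi s‖ ≤ 4 * ‖t‖ * Real.log ‖t‖ := by
    have h4 : 4 ≤ ‖s - 1 / 2‖ := hnorm ▸ ht
    rw [← hnorm]
    -- The signs of Im t and Re t decide which of s, conj s, conj(1 - s), 1 - s lies in the
    -- quadrant.
    rcases le_total t.im 0 with hi | hi <;> rcases le_abs.1 hre with hr | hr
    · exact norm_logChi_le (by linarith) (by linarith) h4
    · have h := norm_logChi_le (s := starRingEnd ℂ s) (by simp; linarith) (by simp; linarith)
        (by rwa [hconj])
      rwa [hconj, logChi_conj hcut, Complex.norm_conj] at h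
    · have h := norm_logChi_le (s := starRingEnd ℂ (1 - s))
        (by rw [Complex.conj_re, Complex.sub_re, Complex.one_re]; linarith) (by simp; linarith)
        (by rwa [hconj, hsub])
      rwa [hconj, hsub, logChi_conj (one_sub_mem_cutPlane hcut), Complex.norm_conj,
        logChi_one_sub hcut, norm_neg] at h
    · have h := norm_logChi_le (s := 1 - s)
        (by rw [Complex.sub_re, Complex.one_re]; linarith) (by simp; linarith) (by rwa [hsub])
      rwa [hsub, logChi_one_sub hcut, norm_neg] at h
  have hc : ‖-(1 / (2 * Complex.I))‖ = 1 / 2 := by simp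
  rw [riemannSiegelTheta, norm_mul, hc]
  linarith
end
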